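/- Let $\mathcal M=(S,A,T,R,\beta)$ be a Markov decision process with finite state space $S$, finite nonempty sets $A(s)\subseteq A$ of available actions, transition probabilities $T(s'|s,a)$, real rewards $R(s,a,s')$ and initial distribution $\beta$, together with finitely many steady-state specifications $(L_i,[l_i,u_i])$, $L_i\subseteq S$. Write $R(s,a)=\sum_{s'}T(s'|s,a)R(s,a,s')$. The transition graph of $\mathcal M$ has an edge $s\to s'$ if $T(s'|s,a)>0$ for some $a\in A(s)$; that of a Markov chain has an edge $s\to s'$ if the transition probability from $s$ to $s'$ is positive. A terminal strongly connected component (TSCC) is a strongly connected component of the graph that is reachable from some $s$ with $\beta_s>0$ and has no edge leaving it. Let $r(\mathcal M)$ be the union of the TSCCs of $\mathcal M$ and, for a stationary policy $\pi$ (with $\pi(\cdot|s)$ a probability distribution on $A(s)$), let $r(\mathcal M_\pi)$ be the union of the TSCCs of the Markov chain $\mathcal M_\pi$ with transition probabilities $T_\pi(s'|s)=\sum_{a\in A(s)}T(s'|s,a)\pi(a|s)$ and initial distribution $\beta$. For $\delta>0$ put $$\Pi_{EP}(\delta)=\{\pi \text{ stationary}: r(\mathcal M_\pi)=r(\mathcal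 M),\ \pi(a|s)\ge\delta\ \ \forall s\in r(\mathcal M),\,a\in A(s)\}.$$ With $S_0\sim\beta$ and actions drawn from $\pi$, let $\mathrm{Pr}^\infty_\pi(s,a)=\lim_n\frac1n\sum_{t=1}^n\Pr(S_t=s,A_t=a)$ and $R^\infty_\pi(\beta)=\liminf_n\frac1n\sum_{t=1}^n\mathbb E[R(S_t,A_t)]$. The policy $\pi$ meets the specifications if $l_i\le\sum_{s\in L_i}\sum_{a\in A(s)}\mathrm{Pr}^\infty_\pi(s,a)\le u_i$ for all $i$. The linear program $\mathrm{LP}_1(\delta)$ maximizes $\sum_{s}\sum_{a\in A(s)}x_{sa}R(s,a)$ over $x_{sa}\in[0,1]$, $y_{sa}\ge0$ ($s\in S$, $a\in A(s)$) subject to $$\sum_{s}\sum_{a\in A(s)}x_{sa}T(s'|s,a)=\sum_{a\in A(s')}x_{s'a},\qquad \sum_{s}\sum_{a\in A(s)}y_{sa}T(s'|s,a)=\sum_{a\in A(s')}(x_{s'a}+y_{s'a})-\beta_{s'}\qquad(s'\in S),$$ $$\sum_{f\notin r(\mathcal M)}\sum_{a\in A(f)}x_{fa}=0,\qquad l_i\le\sum_{s\in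 L_i}\sum_{a\in A(s)}x_{sa}\le u_i\ \ \forall i,\qquad x_{sa}\ge\delta\ \ \forall s\in r(\mathcal M),\,a\in A(s).$$ A policy derived from a feasible point $(x,y)$ is any stationary policy $\pi$ such that, with $x_s=\sum_{a\in A(s)}x_{sa}$ and $y_s=\sum_{a\in A(s)}y_{sa}$, one has $\pi(a|s)=x_{sa}/x_s$ if $x_s>0$, and $\pi(a|s)=y_{sa}/y_s$ if $x_s=0$ and $y_s>0$ ($\pi(\cdot|s)$ is arbitrary otherwise). Then: 1. For every $\delta>0$, every policy derived from a feasible solution of $\mathrm{LP}_1(\delta)$ belongs to $\Pi_{EP}(\delta)$. 2. Suppose that, for all sufficiently small $\delta>0$, $(x^*_\delta,y^*_\delta)$ is an optimal solution of $\mathrm{LP}_1(\delta)$ and $\pi^*_\delta$ is a policy derived from it, and let $R^*(\delta)=R^\infty_{\pi^*_\delta}(\beta)$. Then for all sufficiently small $\delta>0$ the set $\{R^\infty_\pi(\beta):\pi\in\Pi_{EP}(\delta),\ \pi\text{ meets the specifications}\}$ is nonempty and bounded above, and $$\lim_{\delta\to0^+}\Big(\sup\{R^\infty_\pi(\beta):\pi\in\Pi_{EP}(\delta),\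 \pi\text{ meets the specifications}\}-R^*(\delta)\Big)=0.$$ -/

import Mathlib

open Filter Topology

/-- Finite-state Markov decision process. `avail s` is the finite nonempty set `A(s)` of actions
available at `s`, `trans s a s'` is `T(s' | s, a)`, `reward s a s'` is `R(s, a, s')` and `init` is
the initial distribution `β`. Values at unavailable actions play no role. -/
structure MDP (S A : Type*) [Fintype S] where
  avail : S → Finset A
  avail_nonempty : ∀ s, (avail s).Nonempty
  trans : S → A → S → ℝ
  trans_nonneg : ∀ s, ∀ a ∈ avail s, ∀ s', 0 ≤ trans s a s'
  trans_sum : ∀ s, ∀ a ∈ avail s, ∑ s', trans s a s' = 1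
  reward : S → A → S → ℝ
  init : S → ℝ
  init_nonneg : ∀ s, 0 ≤ init s
  init_sum : ∑ s, init s = 1

/-- Labeled MDP: an MDP with finitely many steady-state specifications `(L_i, [l_i, u_i])`. -/
structure LMDP (S A : Type*) [Fintype S] extends MDP S A where
  numSpecs : ℕ
  label : Fin numSpecs → Finset S
  lower : Fin numSpecs → ℝ
  upper : Fin numSpecs → ℝ

/-! ### Terminal strongly connected components -/

section Digraph

variable {S : Type*}

/-- Strongly connected component of the digraph `E`: a maximal set of vertices any two of which
are joined by directed paths (possibly of length zero) in both directions. -/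
def IsSCC (E : S → S → Prop) (C : Set S) : Prop :=
  Maximal (fun D : Set S => ∀ s ∈ D, ∀ s' ∈ D, Relation.ReflTransGen E s s') C

/-- Terminal strongly connected component, relative to an initial distribution `β`: an SCC that is
reachable from some state with `β s > 0` and has no edge leaving it. -/
def IsTSCC (E : S → S → Prop) (β : S → ℝ) (C : Set S) : Prop :=
  IsSCC E C ∧
  (∃ s, 0 < β s ∧ ∃ s' ∈ C, Relation.ReflTransGen E s s') ∧
  (∀ s ∈ C, ∀ s', E s s' → s' ∈ C)

/-- The union `r` of all terminal strongly connected components. -/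
def tsccUnion (E : S → S → Prop) (β : S → ℝ) : Set S :=
  {s | ∃ C, IsTSCC E β C ∧ s ∈ C}

end Digraph

namespace MDP

variable {S A : Type*} [Fintype S]

/-- Edges of the transition graph of the MDP. -/
def Edge (M : MDP S A) (s s' : S) : Prop := ∃ a ∈ M.avail s, 0 < M.trans s a s'

/-- `r(M)`: the union of the TSCCs of the MDP. -/
def recurrentSet (M : MDP S A) : Set S := tsccUnion M.Edge M.init

/-- Stationary policies: `π s a` is `π(a | s)`, a probability distribution on `A(s)`. -/
structure IsStationaryPolicy (M : MDP S A) (π : S → A → ℝ) : Prop where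
  nonneg : ∀ s a, 0 ≤ π s a
  support : ∀ s, ∀ a ∉ M.avail s, π s a = 0
  sum_eq_one : ∀ s, ∑ a ∈ M.avail s, π s a = 1

/-- Transition probabilities `T_π(s' | s)` of the Markov chain induced by `π`. -/
def chainTrans (M : MDP S A) (π : S → A → ℝ) (s s' : S) : ℝ :=
  ∑ a ∈ M.avail s, M.trans s a s' * π s a

/-- `r(M_π)`: the union of the TSCCs of the Markov chain induced by `π`. -/
def recurrentSetOf (M : MDP S A) (π : S → A → ℝ) : Set S :=
  tsccUnion (fun s s' => 0 < M.chainTrans π s s') M.init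

/-- Edge-preserving policies. -/
def edgePreserving (M : MDP S A) : Set (S → A → ℝ) :=
  {π | M.IsStationaryPolicy π ∧ M.recurrentSetOf π = M.recurrentSet ∧
    ∀ s ∈ M.recurrentSet, ∀ a ∈ M.avail s, 0 < π s a}

/-- Edge-preserving policies of support bounded below by `δ`. -/
def edgePreservingBdd (M : MDP S A) (δ : ℝ) : Set (S → A → ℝ) :=
  {π | M.IsStationaryPolicy π ∧ M.recurrentSetOf π = M.recurrentSet ∧
    ∀ s ∈ M.recurrentSet, ∀ a ∈ M.avail s, δ ≤ π s a}

/-! ### Steady-state distribution and average reward -/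

/-- `Pr(S_t = s | β, π)`, with `S_0 ∼ β`. -/
def stateProb (M : MDP S A) (π : S → A → ℝ) : ℕ → S → ℝ
  | 0 => M.init
  | t + 1 => fun s' => ∑ s, M.stateProb π t s * M.chainTrans π s s'

/-- `Pr(S_t = s, A_t = a | β, π)`. -/
def stateActionProb (M : MDP S A) (π : S → A → ℝ) (t : ℕ) (s : S) (a : A) : ℝ :=
  M.stateProb π t s * π s a

/-- `p` is the steady-state distribution (occupation measure) `Pr^∞_π` on the available
state-action pairs: the limit of the time averages exists and equals `p`. -/
def IsSteadyState (M : MDP S A) (π p : S → A → ℝ) : Prop :=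
  ∀ s, ∀ a ∈ M.avail s,
    Tendsto (fun n : ℕ => (1 / (n : ℝ)) * ∑ t ∈ Finset.Icc 1 n, M.stateActionProb π t s a)
      atTop (𝓝 (p s a))

/-- `R(s, a) = ∑ s', T(s' | s, a) R(s, a, s')`. -/
def meanReward (M : MDP S A) (s : S) (a : A) : ℝ :=
  ∑ s', M.trans s a s' * M.reward s a s'

/-- `E[R(S_t, A_t)]` under `π` and `β`. -/
def expReward (M : MDP S A) (π : S → A → ℝ) (t : ℕ) : ℝ :=
  ∑ s, ∑ a ∈ M.avail s, M.stateActionProb π t s a * M.meanReward s a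

/-- Expected average reward `R^∞_π(β)`. -/
noncomputable def avgReward (M : MDP S A) (π : S → A → ℝ) : ℝ :=
  liminf (fun n : ℕ => (1 / (n : ℝ)) * ∑ t ∈ Finset.Icc 1 n, M.expReward π t) atTop

/-! ### The linear program -/

open Classical in
/-- The constraint set `Q_0`. -/
structure InQ0 (M : MDP S A) (x y : S → A → ℝ) : Prop where
  stationary : ∀ s', ∑ s, ∑ a ∈ M.avail s, x s a * M.trans s a s' = ∑ a ∈ M.avail s', x s' a
  flow : ∀ s', ∑ s, ∑ a ∈ M.avail s, y s a * M.trans s a s' =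
    ∑ a ∈ M.avail s', (x s' a + y s' a) - M.init s'
  nonrecurrent : ∑ f ∈ Finset.univ.filter (fun f => f ∉ M.recurrentSet),
    ∑ a ∈ M.avail f, x f a = 0
  x_mem : ∀ s, ∀ a ∈ M.avail s, x s a ∈ Set.Icc (0 : ℝ) 1
  y_nonneg : ∀ s, ∀ a ∈ M.avail s, 0 ≤ y s a

/-- The objective `∑ x_{sa} R(s, a)`. -/
def lpObjective (M : MDP S A) (x : S → A → ℝ) : ℝ :=
  ∑ s, ∑ a ∈ M.avail s, x s a * M.meanReward s a

/-- `π` is a policy obtained from `(x, y)`: `π(a|s) = x_{sa}/x_s` where `x_s > 0`,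
`π(a|s) = y_{sa}/y_s` where `x_s` is not positive but `y_s > 0`, and arbitrary elsewhere. -/
structure IsPolicyFrom (M : MDP S A) (x y π : S → A → ℝ) : Prop where
  stationaryPolicy : M.IsStationaryPolicy π
  eq_x : ∀ s, 0 < ∑ b ∈ M.avail s, x s b →
    ∀ a ∈ M.avail s, π s a = x s a / ∑ b ∈ M.avail s, x s b
  eq_y : ∀ s, ¬ 0 < ∑ b ∈ M.avail s, x s b → 0 < ∑ b ∈ M.avail s, y s b →
    ∀ a ∈ M.avail s, π s a = y s a / ∑ b ∈ M.avail s, y s b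

end MDP

namespace LMDP

variable {S A : Type*} [Fintype S]

/-- The chain induced by `π` meets every steady-state specification. -/
def MeetsSpecs (M : LMDP S A) (π : S → A → ℝ) : Prop :=
  ∃ p : S → A → ℝ, M.IsSteadyState π p ∧
    ∀ i, ∑ s ∈ M.label i, ∑ a ∈ M.avail s, p s a ∈ Set.Icc (M.lower i) (M.upper i)

/-- Feasible points of `LP_1(δ)`. -/
structure IsFeasible (M : LMDP S A) (δ : ℝ) (x y : S → A → ℝ) : Prop where
  inQ0 : M.InQ0 x y
  specs : ∀ i, ∑ s ∈ M.label i, ∑ a ∈ M.avail s, x s a ∈ Set.Icc (M.lower i) (M.upper i)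
  bounded : ∀ s ∈ M.recurrentSet, ∀ a ∈ M.avail s, δ ≤ x s a

/-- Optimal solutions of `LP_1(δ)`. -/
def IsOptimal (M : LMDP S A) (δ : ℝ) (x y : S → A → ℝ) : Prop :=
  M.IsFeasible δ x y ∧ ∀ x' y', M.IsFeasible δ x' y' → M.lpObjective x' ≤ M.lpObjective x

/-- The average rewards of the policies in `Π_EP(δ)` that meet the specifications. -/
def admissibleRewards (M : LMDP S A) (δ : ℝ) : Set ℝ :=
  M.avgReward '' {π | π ∈ M.edgePreservingBdd δ ∧ M.MeetsSpecs π}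

end LMDP

/-!
Fix a stationary policy with transition matrix `P`. The time averages of `β P^t` converge to `p` if
and only if `p P = p` and `β` and `p` have the same pairing with every harmonic function `h = P h`:
by linear duality the latter provides a potential `z` with `z - z P = β - p`, and the averages of
`p + (z - z P)` telescope. A harmonic function is constant along every edge leaving a state charged
by an invariant `p ≥ 0`, because the Dirichlet form `∑ p_s P_{ss'} (h_s - h_{s'})²` vanishes.

Pairing the flow constraint of the linear program with a harmonic `h` therefore yields
`β · h = x · h`, so `x` is the steady state of the derived policy. The states it charges are the
recurrent states of the chain, and they are those of `M` by the constraints on `x`. Conversely, the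
steady state of an edge-preserving policy and a nonnegative potential form a feasible point for all
small `δ`. Hence, as `δ` decreases to `0`, the optimal values eventually exceed every admissible
reward, while they are themselves admissible and bounded.
-/

section Digraph

variable {S : Type*} {E : S → S → Prop} {β : S → ℝ} {s : S}

theorem mem_tsccUnion_iff :
    s ∈ tsccUnion E β ↔ (∃ s₀, 0 < β s₀ ∧ Relation.ReflTransGen E s₀ s) ∧
      ∀ s', Relation.ReflTransGen E s s' → Relation.ReflTransGen E s' s := by
  constructor
  · rintro ⟨C, ⟨hC, ⟨s₀, hs₀, t, ht, hst⟩, hclosed⟩, hs⟩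
    refine ⟨⟨s₀, hs₀, hst.trans (hC.prop t ht s hs)⟩, fun s' hss' => hC.prop s' ?_ s hs⟩
    induction hss' with
    | refl => exact hs
    | tail _ hedge ih => exact hclosed _ ih _ hedge
  · rintro ⟨⟨s₀, hs₀, hreach⟩, hreturn⟩
    refine ⟨{t | Relation.ReflTransGen E s t}, ⟨⟨?_, ?_⟩, ⟨s₀, hs₀, s, .refl, hreach⟩, ?_⟩, .refl⟩
    · exact fun t ht u hu => (hreturn t ht).trans hu
    · exact fun D hD hle d hd => hD s (hle .refl) d hd
    · exact fun t ht u htu => ht.tail htu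

end Digraph

open Matrix in
theorem exists_vecMul_eq_of_forall_mulVec_eq_zero {K m n : Type*} [Field K] [Fintype m] [Fintype n]
    {A : Matrix m n K} {d : n → K} (h : ∀ v, A *ᵥ v = 0 → d ⬝ᵥ v = 0) : ∃ z, z ᵥ* A = d := by
  classical
  have hd : dotProductEquiv K n d ∈ A.mulVecLin.ker.dualAnnihilator :=
    (Submodule.mem_dualAnnihilator _).2 fun v hv => h v (by simpa using hv)
  rw [← LinearMap.range_dualMap_eq_dualAnnihilator_ker] at hd
  obtain ⟨φ, hφ⟩ := hd
  obtain ⟨z, rfl⟩ := (dotProductEquiv K m).surjective φ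
  refine ⟨z, (dotProductEquiv K n).injective (LinearMap.ext fun v => ?_)⟩
  rw [← hφ]
  simp [dotProduct_mulVec]

section MarkovChain

open Matrix

variable {S : Type*} [Fintype S] {P : Matrix S S ℝ} {β f p v : S → ℝ} {s s' : S}

theorem vecMul_nonneg (hP : ∀ s s', 0 ≤ P s s') (hv : 0 ≤ v) : 0 ≤ v ᵥ* P :=
  fun _ => Finset.sum_nonneg fun u _ => mul_nonneg (hv u) (hP u _)

theorem vecMul_apply_pos (hP : ∀ s s', 0 ≤ P s s') (hv : 0 ≤ v) (hs : 0 < v s)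
    (hedge : 0 < P s s') : 0 < (v ᵥ* P) s' :=
  Finset.sum_pos' (fun u _ => mul_nonneg (hv u) (hP u s'))
    ⟨s, Finset.mem_univ s, mul_pos hs hedge⟩

/-! ### Invariant and subharmonic vectors -/

theorem pos_of_reflTransGen (hP : ∀ s s', 0 ≤ P s s') (hp : 0 ≤ p) (hinv : p ᵥ* P = p)
    (hs : 0 < p s) (h : Relation.ReflTransGen (0 < P · ·) s s') : 0 < p s' := by
  induction h with
  | refl => exact hs
  | tail _ hedge ih => exact hinv ▸ vecMul_apply_pos hP hp ih hedge

theorem vecMul_eq_of_le (hP : P *ᵥ 1 = 1) (hv : v ≤ v ᵥ* P) : v ᵥ* P = v := by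
  have hsum : ∑ s, v s = ∑ s, (v ᵥ* P) s := by
    simpa [dotProduct_one, hP] using dotProduct_mulVec v P 1
  exact funext fun s =>
    ((Finset.sum_eq_sum_iff_of_le fun t _ => hv t).1 hsum s (Finset.mem_univ s)).symm

theorem sum_mul_sub_sq (hP : P *ᵥ 1 = 1) (hinv : p ᵥ* P = p) :
    ∑ s, ∑ s', p s * P s s' * (f s - f s') ^ 2 =
      2 * ∑ s, f s * (p s * (f s - (P *ᵥ f) s)) := by
  have hsource : ∑ s, ∑ s', p s * P s s' * f s ^ 2 = ∑ s, p s * f s ^ 2 := by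
    refine Finset.sum_congr rfl fun s _ => ?_
    have hrow : ∑ s', P s s' = 1 := by
      simpa [mulVec, dotProduct] using congrFun hP s
    rw [← Finset.sum_mul, ← Finset.mul_sum, hrow, mul_one]
  have htarget : ∑ s, ∑ s', p s * P s s' * f s' ^ 2 = ∑ s, p s * f s ^ 2 := by
    rw [Finset.sum_comm]
    refine Finset.sum_congr rfl fun s' _ => ?_
    rw [← Finset.sum_mul]
    exact congrArg (· * f s' ^ 2) (congrFun hinv s')
  have hcross : ∑ s, ∑ s', p s * P s s' * (f s * f s') = ∑ s, f s * (p s * (P *ᵥ f) s) := by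
    refine Finset.sum_congr rfl fun s _ => ?_
    simp only [mulVec, dotProduct, Finset.mul_sum]
    exact Finset.sum_congr rfl fun s' _ => by ring
  calc ∑ s, ∑ s', p s * P s s' * (f s - f s') ^ 2
      = ∑ s, ∑ s', p s * P s s' * f s ^ 2 + ∑ s, ∑ s', p s * P s s' * f s' ^ 2
          - 2 * ∑ s, ∑ s', p s * P s s' * (f s * f s') := by
        simp only [Finset.mul_sum, ← Finset.sum_add_distrib, ← Finset.sum_sub_distrib]
        exact Finset.sum_congr rfl fun s _ => Finset.sum_congr rfl fun s' _ => by ring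
    _ = 2 * ∑ s, f s * (p s * (f s - (P *ᵥ f) s)) := by
        rw [hsource, htarget, hcross]
        simp only [Finset.mul_sum, ← Finset.sum_add_distrib, ← Finset.sum_sub_distrib]
        exact Finset.sum_congr rfl fun s _ => by ring

theorem mul_sub_mulVec_eq_zero (hp : 0 ≤ p) (hinv : p ᵥ* P = p) (hf : f ≤ P *ᵥ f) (s : S) :
    p s * (f s - (P *ᵥ f) s) = 0 := by
  have hsum : ∑ s, p s * (f s - (P *ᵥ f) s) = 0 := by
    change p ⬝ᵥ (f - P *ᵥ f) = 0
    rw [dotProduct_sub, dotProduct_mulVec, hinv, sub_self]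
  refine (Finset.sum_eq_zero_iff_of_nonpos fun t _ => ?_).1 hsum s (Finset.mem_univ s)
  exact mul_nonpos_of_nonneg_of_nonpos (hp t) (sub_nonpos.2 (hf t))

theorem eq_of_le_mulVec_of_pos [DecidableEq S] (hP : P ∈ rowStochastic ℝ S) (hp : 0 ≤ p)
    (hinv : p ᵥ* P = p) (hf : f ≤ P *ᵥ f) (hs : 0 < p s) (hedge : 0 < P s s') : f s = f s' := by
  have hnonneg (u v : S) : 0 ≤ p u * P u v * (f u - f v) ^ 2 :=
    mul_nonneg (mul_nonneg (hp u) (hP.1 u v)) (sq_nonneg _)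
  have hzero : ∑ u, ∑ v, p u * P u v * (f u - f v) ^ 2 = 0 := by
    simp only [sum_mul_sub_sq hP.2 hinv, mul_sub_mulVec_eq_zero hp hinv hf, mul_zero,
      Finset.sum_const_zero]
  rw [Fintype.sum_eq_zero_iff_of_nonneg fun u => Finset.sum_nonneg fun v _ => hnonneg u v] at hzero
  have hs' := (Fintype.sum_eq_zero_iff_of_nonneg (hnonneg s)).1 (congrFun hzero s)
  simpa [sub_eq_zero, hs.ne', hedge.ne'] using congrFun hs' s'

theorem eq_of_le_mulVec_of_reflTransGen [DecidableEq S] (hP : P ∈ rowStochastic ℝ S) (hp : 0 ≤ p)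
    (hinv : p ᵥ* P = p) (hf : f ≤ P *ᵥ f) (hs : 0 < p s)
    (h : Relation.ReflTransGen (0 < P · ·) s s') : f s = f s' := by
  induction h with
  | refl => rfl
  | tail hsu hedge ih =>
    exact ih.trans
      (eq_of_le_mulVec_of_pos hP hp hinv hf (pos_of_reflTransGen hP.1 hp hinv hs hsu) hedge)

theorem indicator_le_mulVec_indicator [DecidableEq S] (hP : P ∈ rowStochastic ℝ S) {C : Set S}
    (hC : ∀ s ∈ C, ∀ s', 0 < P s s' → s' ∈ C) :
    C.indicator 1 ≤ P *ᵥ (C.indicator 1 : S → ℝ) := by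
  intro s
  have hC0 : (0 : S → ℝ) ≤ C.indicator 1 := Set.indicator_nonneg fun _ _ => zero_le_one
  by_cases hs : s ∈ C
  · rw [Set.indicator_of_mem hs, Pi.one_apply, ← sum_row_of_mem_rowStochastic hP s]
    refine Finset.sum_le_sum fun s' _ => ?_
    rcases (hP.1 s s').eq_or_lt with h0 | hpos
    · simp [← h0]
    · simp [Set.indicator_of_mem (hC s hs s' hpos)]
  · rw [Set.indicator_of_notMem hs]
    exact Finset.sum_nonneg fun s' _ => mul_nonneg (hP.1 s s') (hC0 s')

theorem reflTransGen_symm_of_pos [DecidableEq S] (hP : P ∈ rowStochastic ℝ S) (hp : 0 ≤ p)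
    (hinv : p ᵥ* P = p) (hs : 0 < p s) (h : Relation.ReflTransGen (0 < P · ·) s s') :
    Relation.ReflTransGen (0 < P · ·) s' s := by
  set C : Set S := {u | Relation.ReflTransGen (0 < P · ·) s' u}
  have hC : C.indicator 1 ≤ P *ᵥ (C.indicator 1 : S → ℝ) :=
    indicator_le_mulVec_indicator hP fun _ hu _ huv => hu.tail huv
  have heq := eq_of_le_mulVec_of_reflTransGen hP hp hinv hC hs h
  rw [Set.indicator_of_mem (show s' ∈ C from .refl)] at heq
  by_contra hs'
  simp [Set.indicator_of_notMem (show s ∉ C from hs')] at heq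

/-- After adding a multiple of `p`, the potential `z` is negative only where `p` vanishes. Its
negative part is then dominated by its own image, hence invariant, and may be removed. -/
theorem exists_nonneg_sub_vecMul_eq_of_sub_vecMul_eq [DecidableEq S]
    (hP : P ∈ rowStochastic ℝ S) (hβ : 0 ≤ β) (hp : 0 ≤ p) (hinv : p ᵥ* P = p) {z : S → ℝ}
    (hz : z - z ᵥ* P = β - p) : ∃ y, 0 ≤ y ∧ y - y ᵥ* P = β - p := by
  obtain ⟨c, hc⟩ : ∃ c : ℝ, ∀ s, 0 < p s → 0 ≤ z s + c * p s := by
    refine ⟨∑ s, |z s| / p s, fun s hs => ?_⟩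
    have hle : |z s| / p s ≤ ∑ s, |z s| / p s :=
      Finset.single_le_sum (f := fun s => |z s| / p s)
        (fun t _ => div_nonneg (abs_nonneg _) (hp t)) (Finset.mem_univ s)
    linarith [(div_le_iff₀ hs).1 hle, neg_abs_le (z s)]
  set u : S → ℝ := z + c • p with hu
  have hpot : u - u ᵥ* P = β - p := by
    rw [hu, add_vecMul, smul_vecMul, hinv, ← hz]
    abel
  have hneg : u⁻ ≤ u⁻ ᵥ* P := by
    intro s
    have hnonneg := vecMul_nonneg hP.1 (negPart_nonneg u) s
    rcases (hp s).lt_or_eq with hps | hps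
    · rwa [Pi.negPart_apply, negPart_eq_zero.2 (by simpa [hu] using hc s hps)]
    · have hle : (-u ᵥ* P) s ≤ (u⁻ ᵥ* P) s := Finset.sum_le_sum fun t _ =>
        mul_le_mul_of_nonneg_right (neg_le_negPart u t) (hP.1 t s)
      have hs := congrFun hpot s
      simp only [neg_vecMul, Pi.sub_apply, Pi.neg_apply] at hle hs
      exact sup_le (by simp only [Pi.neg_apply]; linarith [hβ s]) hnonneg
  refine ⟨u⁺, posPart_nonneg u, ?_⟩
  have hpos : u⁺ = u + u⁻ := by rw [← sub_eq_iff_eq_add, posPart_sub_negPart]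
  rw [hpos, add_vecMul, vecMul_eq_of_le hP.2 hneg, ← hpot]
  abel

/-! ### Time averages -/

/-- `p` is the limit of the averages of `β, β ᵥ* P, …, β ᵥ* P ^ (n - 1)`, that is, the long-run
occupation frequency of the chain `P` started from `β`. -/
def IsTimeAverageLimit (P : Matrix S S ℝ) (β p : S → ℝ) : Prop :=
  Tendsto (birkhoffAverage ℝ P.vecMulLinear id · β) atTop (𝓝 p)

theorem isBounded_range_iterate_vecMul [DecidableEq S] (hP : P ∈ rowStochastic ℝ S) (v : S → ℝ) :
    Bornology.IsBounded (Set.range fun k => P.vecMulLinear^[k] v) := by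
  have hiter (k : ℕ) : P.vecMulLinear^[k] v = v ᵥ* P ^ k := by
    induction k with
    | zero => simp
    | succ k ih =>
      rw [Function.iterate_succ_apply', ih, vecMulLinear_apply, vecMul_vecMul, pow_succ]
  refine isBounded_iff_forall_norm_le.2 ⟨∑ s, |v s|, Set.forall_mem_range.2 fun k => ?_⟩
  refine (pi_norm_le_iff_of_nonneg (Finset.sum_nonneg fun s _ => abs_nonneg (v s))).2 fun s' => ?_
  rw [hiter]
  refine (Finset.abs_sum_le_sum_abs _ _).trans (Finset.sum_le_sum fun s _ => ?_)
  have hPk := pow_mem hP k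
  rw [abs_mul, abs_of_nonneg (hPk.1 s s')]
  exact mul_le_of_le_one_right (abs_nonneg _) (le_one_of_mem_rowStochastic hPk)

theorem tendsto_birkhoffAverage_vecMul_sub [DecidableEq S] (hP : P ∈ rowStochastic ℝ S)
    (v : S → ℝ) :
    Tendsto (fun n => birkhoffAverage ℝ P.vecMulLinear id n (v ᵥ* P) -
      birkhoffAverage ℝ P.vecMulLinear id n v) atTop (𝓝 0) :=
  tendsto_birkhoffAverage_apply_sub_birkhoffAverage ℝ (f := P.vecMulLinear) (g := id)
    (isBounded_range_iterate_vecMul hP v)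

theorem isTimeAverageLimit_vecMul_iff [DecidableEq S] (hP : P ∈ rowStochastic ℝ S) :
    IsTimeAverageLimit P (β ᵥ* P) p ↔ IsTimeAverageLimit P β p := by
  have hdiff := tendsto_birkhoffAverage_vecMul_sub hP β
  exact ⟨fun h => by simpa [IsTimeAverageLimit] using h.sub hdiff,
    fun h => by simpa [IsTimeAverageLimit] using h.add hdiff⟩

theorem isTimeAverageLimit_of_sub_vecMul_eq [DecidableEq S] (hP : P ∈ rowStochastic ℝ S)
    (hinv : p ᵥ* P = p) {z : S → ℝ} (hz : z - z ᵥ* P = β - p) : IsTimeAverageLimit P β p := by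
  obtain rfl : β = p - (z ᵥ* P - z) := by
    rw [← neg_sub z, hz]
    abel
  have hfix := Function.IsFixedPt.tendsto_birkhoffAverage ℝ (f := P.vecMulLinear) hinv id
  simpa [IsTimeAverageLimit, birkhoffAverage, birkhoffSum, iterate_map_sub, smul_sub] using
    hfix.sub (tendsto_birkhoffAverage_vecMul_sub hP z)

namespace IsTimeAverageLimit

theorem mem_of_mapsTo (hlim : IsTimeAverageLimit P β p) {K : Set (S → ℝ)} (hconv : Convex ℝ K)
    (hclosed : IsClosed K) (hmaps : Set.MapsTo (· ᵥ* P) K K) (hβ : β ∈ K) : p ∈ K := by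
  refine hclosed.mem_of_tendsto hlim ?_
  filter_upwards [eventually_gt_atTop 0] with n hn
  rw [birkhoffAverage, birkhoffSum, Finset.smul_sum]
  refine hconv.sum_mem (fun _ _ => by positivity) ?_ fun k _ => hmaps.iterate k hβ
  simp [hn.ne']

theorem vecMul_eq [DecidableEq S] (hlim : IsTimeAverageLimit P β p)
    (hP : P ∈ rowStochastic ℝ S) : p ᵥ* P = p := by
  refine tendsto_nhds_unique ?_ ((isTimeAverageLimit_vecMul_iff hP).2 hlim)
  have hcont : Continuous P.vecMulLinear := LinearMap.continuous_of_finiteDimensional _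
  refine ((hcont.tendsto p).comp hlim).congr fun n => ?_
  rw [Function.comp_apply, map_birkhoffAverage ℝ ℝ]
  refine congrArg ((n : ℝ)⁻¹ • ·) (Finset.sum_congr rfl fun k _ => ?_)
  exact (Function.Commute.iterate_right (.refl P.vecMulLinear) k) β

theorem dotProduct_le (hlim : IsTimeAverageLimit P β p) (hP : ∀ s s', 0 ≤ P s s') (hβ : 0 ≤ β)
    (hf : f ≤ P *ᵥ f) : β ⬝ᵥ f ≤ p ⬝ᵥ f := by
  have hconv : Convex ℝ {v : S → ℝ | β ⬝ᵥ f ≤ v ⬝ᵥ f} :=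
    convex_halfSpace_ge ⟨fun v w => add_dotProduct v w f, fun c v => smul_dotProduct c v f⟩ _
  have hclosed : IsClosed {v : S → ℝ | β ⬝ᵥ f ≤ v ⬝ᵥ f} :=
    isClosed_le continuous_const (continuous_id.dotProduct continuous_const)
  refine (hlim.mem_of_mapsTo ((convex_Ici 0).inter hconv) (isClosed_Ici.inter hclosed)
    (fun v hv => ⟨vecMul_nonneg hP hv.1, ?_⟩) ⟨hβ, le_refl (β ⬝ᵥ f)⟩).2
  calc β ⬝ᵥ f ≤ v ⬝ᵥ f := hv.2
    _ ≤ v ⬝ᵥ P *ᵥ f := dotProduct_le_dotProduct_of_nonneg_left hf hv.1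
    _ = v ᵥ* P ⬝ᵥ f := dotProduct_mulVec v P f

theorem nonneg (hlim : IsTimeAverageLimit P β p) (hP : ∀ s s', 0 ≤ P s s') (hβ : 0 ≤ β) : 0 ≤ p :=
  hlim.mem_of_mapsTo (convex_Ici 0) isClosed_Ici (fun _ hv => vecMul_nonneg hP hv) hβ

theorem dotProduct_eq (hlim : IsTimeAverageLimit P β p) (hP : ∀ s s', 0 ≤ P s s') (hβ : 0 ≤ β)
    (hf : P *ᵥ f = f) : β ⬝ᵥ f = p ⬝ᵥ f := by
  refine (hlim.dotProduct_le hP hβ hf.ge).antisymm ?_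
  have hneg := hlim.dotProduct_le hP hβ (f := -f) (by rw [mulVec_neg, hf])
  simpa using hneg

end IsTimeAverageLimit

theorem exists_sub_vecMul_eq (hharm : ∀ h, P *ᵥ h = h → β ⬝ᵥ h = p ⬝ᵥ h) :
    ∃ z, z - z ᵥ* P = β - p := by
  classical
  obtain ⟨z, hz⟩ := exists_vecMul_eq_of_forall_mulVec_eq_zero (A := 1 - P) (d := β - p)
    fun h hh => by
      rw [sub_mulVec, one_mulVec, sub_eq_zero] at hh
      rw [sub_dotProduct, hharm h hh.symm, sub_self]
  exact ⟨z, by rwa [vecMul_sub, vecMul_one] at hz⟩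

theorem isTimeAverageLimit_of_forall_dotProduct_eq [DecidableEq S] (hP : P ∈ rowStochastic ℝ S)
    (hinv : p ᵥ* P = p) (hharm : ∀ h, P *ᵥ h = h → β ⬝ᵥ h = p ⬝ᵥ h) : IsTimeAverageLimit P β p :=
  let ⟨_, hz⟩ := exists_sub_vecMul_eq hharm
  isTimeAverageLimit_of_sub_vecMul_eq hP hinv hz

namespace IsTimeAverageLimit

variable [DecidableEq S]

theorem exists_nonneg_sub_vecMul_eq (hlim : IsTimeAverageLimit P β p) (hP : P ∈ rowStochastic ℝ S)
    (hβ : 0 ≤ β) : ∃ y, 0 ≤ y ∧ y - y ᵥ* P = β - p :=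
  let ⟨_, hz⟩ := exists_sub_vecMul_eq fun _ => hlim.dotProduct_eq hP.1 hβ
  exists_nonneg_sub_vecMul_eq_of_sub_vecMul_eq hP hβ (hlim.nonneg hP.1 hβ) (hlim.vecMul_eq hP) hz

theorem exists_pos_mem_of_reflTransGen (hlim : IsTimeAverageLimit P β p)
    (hP : P ∈ rowStochastic ℝ S) (hβ : 0 ≤ β) {C : Set S}
    (hC : ∀ s ∈ C, ∀ s', 0 < P s s' → s' ∈ C) (hs : 0 < β s)
    (h : Relation.ReflTransGen (0 < P · ·) s s') (hs' : s' ∈ C) : ∃ u ∈ C, 0 < p u := by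
  induction h using Relation.ReflTransGen.head_induction_on generalizing β with
  | refl =>
    have hpos : 0 < β ⬝ᵥ C.indicator 1 := Finset.sum_pos'
      (fun t _ => mul_nonneg (hβ t) (Set.indicator_nonneg (fun _ _ => zero_le_one) t))
      ⟨s', Finset.mem_univ _, by simpa [hs'] using hs⟩
    have hle := hlim.dotProduct_le hP.1 hβ (indicator_le_mulVec_indicator hP hC)
    obtain ⟨u, -, hu⟩ := Finset.exists_ne_zero_of_sum_ne_zero (hpos.trans_le hle).ne'
    have hmem : u ∈ C := Set.mem_of_indicator_ne_zero (right_ne_zero_of_mul hu)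
    exact ⟨u, hmem, (hlim.nonneg hP.1 hβ u).lt_of_ne' (left_ne_zero_of_mul hu)⟩
  | head hedge _ ih =>
    exact ih ((isTimeAverageLimit_vecMul_iff hP).2 hlim) (vecMul_nonneg hP.1 hβ)
      (vecMul_apply_pos hP.1 hβ hs hedge)

theorem exists_reflTransGen_of_pos (hlim : IsTimeAverageLimit P β p)
    (hP : P ∈ rowStochastic ℝ S) (hβ : 0 ≤ β) (hs : 0 < p s) :
    ∃ s₀, 0 < β s₀ ∧ Relation.ReflTransGen (0 < P · ·) s₀ s := by
  set D : Set S := {u | ∃ s₀, 0 < β s₀ ∧ Relation.ReflTransGen (0 < P · ·) s₀ u}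
  have hD : D.indicator 1 ≤ P *ᵥ (D.indicator 1 : S → ℝ) :=
    indicator_le_mulVec_indicator hP fun _ ⟨s₀, hs₀, hu⟩ _ huv => ⟨s₀, hs₀, hu.tail huv⟩
  have hβD : β ⬝ᵥ D.indicator 1 = β ⬝ᵥ 1 := Finset.sum_congr rfl fun t _ => by
    rcases (hβ t).eq_or_lt with h0 | hpos
    · simp [← h0]
    · rw [Set.indicator_of_mem (show t ∈ D from ⟨t, hpos, .refl⟩)]
  have hle : p ⬝ᵥ 1 ≤ p ⬝ᵥ D.indicator 1 :=
    calc p ⬝ᵥ 1 = β ⬝ᵥ D.indicator 1 := by rw [hβD, hlim.dotProduct_eq hP.1 hβ hP.2]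
      _ ≤ p ⬝ᵥ D.indicator 1 := hlim.dotProduct_le hP.1 hβ hD
  by_contra hsD
  refine hle.not_gt (Finset.sum_lt_sum (fun t _ => mul_le_mul_of_nonneg_left
    (Set.indicator_le_self' (fun _ _ => zero_le_one) t) (hlim.nonneg hP.1 hβ t))
    ⟨s, Finset.mem_univ s, ?_⟩)
  simpa [Set.indicator_of_notMem (show s ∉ D from hsD)] using hs

theorem pos_iff_mem_tsccUnion (hlim : IsTimeAverageLimit P β p) (hP : P ∈ rowStochastic ℝ S)
    (hβ : 0 ≤ β) : 0 < p s ↔ s ∈ tsccUnion (0 < P · ·) β := by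
  have hp := hlim.nonneg hP.1 hβ
  have hinv := hlim.vecMul_eq hP
  rw [mem_tsccUnion_iff]
  constructor
  · exact fun hs => ⟨hlim.exists_reflTransGen_of_pos hP hβ hs,
      fun _ => reflTransGen_symm_of_pos hP hp hinv hs⟩
  · rintro ⟨⟨s₀, hs₀, hreach⟩, hreturn⟩
    obtain ⟨u, hu, hpu⟩ := hlim.exists_pos_mem_of_reflTransGen hP hβ
      (C := {u | Relation.ReflTransGen (0 < P · ·) s u}) (fun _ ht _ htu => ht.tail htu)
      hs₀ hreach .refl
    exact pos_of_reflTransGen hP.1 hp hinv hpu (hreturn u hu)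

end IsTimeAverageLimit

end MarkovChain

namespace MDP

open Matrix

variable {S A : Type*} [Fintype S] {M : MDP S A} {π p x y z : S → A → ℝ} {s s' : S} {a : A}

/-! ### The chain induced by a policy -/

/-- The transition matrix of the Markov chain `M_π`. -/
def chainMatrix (M : MDP S A) (π : S → A → ℝ) : Matrix S S ℝ := .of (M.chainTrans π)

/-- The total weight `z_s = ∑ a ∈ A(s), z_{sa}` which `z` gives to the state `s`. -/
def marginal (M : MDP S A) (z : S → A → ℝ) (s : S) : ℝ := ∑ a ∈ M.avail s, z s a

/-- The weights `z` are distributed at the state `s` over the available actions according to `π`.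
Stated as a product, this also makes sense when `z_s = 0`. -/
def FactorsAt (M : MDP S A) (π z : S → A → ℝ) (s : S) : Prop :=
  ∀ a ∈ M.avail s, z s a = M.marginal z s * π s a

theorem marginal_nonneg (hz : ∀ a ∈ M.avail s, 0 ≤ z s a) : 0 ≤ M.marginal z s :=
  Finset.sum_nonneg hz

theorem marginal_pos (hz : ∀ a ∈ M.avail s, 0 < z s a) : 0 < M.marginal z s :=
  Finset.sum_pos hz (M.avail_nonempty s)

theorem factorsAt_of_eq_div (hz : ∀ a ∈ M.avail s, 0 ≤ z s a)
    (hπ : 0 < M.marginal z s → ∀ a ∈ M.avail s, π s a = z s a / M.marginal z s) :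
    M.FactorsAt π z s := by
  intro a ha
  rcases (marginal_nonneg hz).lt_or_eq with hpos | hzero
  · rw [hπ hpos a ha, mul_div_cancel₀ _ hpos.ne']
  · rw [← hzero, zero_mul]
    exact (Finset.sum_eq_zero_iff_of_nonneg hz).1 hzero.symm a ha

theorem chainMatrix_mulVec_apply (h : S → ℝ) :
    (M.chainMatrix π *ᵥ h) s = ∑ a ∈ M.avail s, π s a * (M.trans s a ⬝ᵥ h) := by
  simp only [mulVec, dotProduct, chainMatrix, of_apply, chainTrans, Finset.sum_mul, Finset.mul_sum]
  rw [Finset.sum_comm]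
  exact Finset.sum_congr rfl fun a _ => Finset.sum_congr rfl fun s' _ => by ring

theorem FactorsAt.sum_mul_trans_dotProduct (hz : M.FactorsAt π z s) (h : S → ℝ) :
    ∑ a ∈ M.avail s, z s a * (M.trans s a ⬝ᵥ h) = M.marginal z s * (M.chainMatrix π *ᵥ h) s := by
  rw [chainMatrix_mulVec_apply, Finset.mul_sum]
  exact Finset.sum_congr rfl fun a ha => by rw [hz a ha, mul_assoc]

theorem marginal_vecMul_chainMatrix (hz : ∀ s, M.FactorsAt π z s) :
    (M.marginal z ᵥ* M.chainMatrix π) s' = ∑ s, ∑ a ∈ M.avail s, z s a * M.trans s a s' := by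
  refine Finset.sum_congr rfl fun s _ => ?_
  change M.marginal z s * M.chainTrans π s s' = _
  rw [chainTrans, Finset.mul_sum]
  exact Finset.sum_congr rfl fun a ha => by rw [hz s a ha, mul_assoc, mul_comm (π s a)]

theorem chainTrans_pos (hπ : M.IsStationaryPolicy π) (ha : a ∈ M.avail s) (hpos : 0 < π s a)
    (hT : 0 < M.trans s a s') : 0 < M.chainTrans π s s' :=
  Finset.sum_pos' (fun b hb => mul_nonneg (M.trans_nonneg s b hb s') (hπ.nonneg s b))
    ⟨a, ha, mul_pos hT hpos⟩

namespace IsStationaryPolicy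

theorem chainMatrix_mem_rowStochastic [DecidableEq S] (hπ : M.IsStationaryPolicy π) :
    M.chainMatrix π ∈ rowStochastic ℝ S := by
  refine ⟨fun s s' => Finset.sum_nonneg fun a ha =>
    mul_nonneg (M.trans_nonneg s a ha s') (hπ.nonneg s a), funext fun s => ?_⟩
  rw [chainMatrix_mulVec_apply, Pi.one_apply, ← hπ.sum_eq_one s]
  exact Finset.sum_congr rfl fun a ha => by rw [dotProduct_one, M.trans_sum s a ha, mul_one]

theorem le_one (hπ : M.IsStationaryPolicy π) (ha : a ∈ M.avail s) : π s a ≤ 1 :=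
  hπ.sum_eq_one s ▸ Finset.single_le_sum (fun b _ => hπ.nonneg s b) ha

theorem marginal_mul (hπ : M.IsStationaryPolicy π) (v : S → ℝ) :
    M.marginal (fun s a => v s * π s a) = v :=
  funext fun s => by rw [marginal, ← Finset.mul_sum, hπ.sum_eq_one, mul_one]

end IsStationaryPolicy

/-! ### Steady states -/

theorem stateProb_eq_iterate (t : ℕ) :
    M.stateProb π t = (M.chainMatrix π).vecMulLinear^[t] M.init := by
  induction t with
  | zero => rfl
  | succ t ih => rw [Function.iterate_succ_apply', ← ih]; rfl

theorem average_stateActionProb (n : ℕ) :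
    (1 / (n : ℝ)) * ∑ t ∈ Finset.Icc 1 n, M.stateActionProb π t s a =
      birkhoffAverage ℝ (M.chainMatrix π).vecMulLinear id n (M.init ᵥ* M.chainMatrix π) s *
        π s a := by
  rw [← Finset.Ico_succ_right_eq_Icc, Finset.sum_Ico_eq_sum_range]
  simp [birkhoffAverage, birkhoffSum, stateActionProb, stateProb_eq_iterate, add_comm 1,
    ← Finset.sum_mul, mul_assoc]

theorem isSteadyState_iff (hπ : M.IsStationaryPolicy π) :
    M.IsSteadyState π p ↔ IsTimeAverageLimit (M.chainMatrix π) M.init (M.marginal p) ∧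
      ∀ s, M.FactorsAt π p s := by
  classical
  rw [← isTimeAverageLimit_vecMul_iff hπ.chainMatrix_mem_rowStochastic, IsTimeAverageLimit,
    tendsto_pi_nhds]
  simp only [IsSteadyState, average_stateActionProb]
  constructor
  · intro hp
    have hlim (s : S) : Tendsto (fun n => birkhoffAverage ℝ (M.chainMatrix π).vecMulLinear id n
        (M.init ᵥ* M.chainMatrix π) s) atTop (𝓝 (M.marginal p s)) := by
      refine (tendsto_finsetSum _ (hp s)).congr fun n => ?_
      rw [← Finset.mul_sum, hπ.sum_eq_one, mul_one]
    exact ⟨hlim, fun s a ha => tendsto_nhds_unique (hp s a ha) ((hlim s).mul_const _)⟩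
  · rintro ⟨hlim, hfac⟩ s a ha
    rw [hfac s a ha]
    exact (hlim s).mul_const _

namespace IsSteadyState

theorem avgReward_eq (hp : M.IsSteadyState π p) : M.avgReward π = M.lpObjective p := by
  have hlim : Tendsto (fun n : ℕ => ∑ s, ∑ a ∈ M.avail s,
      ((1 / (n : ℝ)) * ∑ t ∈ Finset.Icc 1 n, M.stateActionProb π t s a) * M.meanReward s a)
      atTop (𝓝 (M.lpObjective p)) :=
    tendsto_finsetSum _ fun s _ => tendsto_finsetSum _ fun a ha => (hp s a ha).mul_const _
  refine (hlim.congr fun n => ?_).liminf_eq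
  simp only [expReward, Finset.mul_sum, Finset.sum_mul, mul_assoc]
  symm
  rw [Finset.sum_comm]
  exact Finset.sum_congr rfl fun s _ => Finset.sum_comm

theorem marginal_pos_iff (hp : M.IsSteadyState π p) (hπ : M.IsStationaryPolicy π) :
    0 < M.marginal p s ↔ s ∈ M.recurrentSetOf π := by
  classical
  exact ((isSteadyState_iff hπ).1 hp).1.pos_iff_mem_tsccUnion hπ.chainMatrix_mem_rowStochastic
    M.init_nonneg

theorem pos (hp : M.IsSteadyState π p) (hπ : π ∈ M.edgePreserving) (hs : s ∈ M.recurrentSet)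
    (ha : a ∈ M.avail s) : 0 < p s a := by
  rw [((isSteadyState_iff hπ.1).1 hp).2 s a ha]
  exact mul_pos ((hp.marginal_pos_iff hπ.1).2 (hπ.2.1 ▸ hs)) (hπ.2.2 s hs a ha)

end IsSteadyState

/-! ### Points of `Q_0` -/

namespace InQ0

theorem sum_mul_trans_dotProduct (hq : M.InQ0 x y) (h : S → ℝ) :
    ∑ s, ∑ a ∈ M.avail s, y s a * (M.trans s a ⬝ᵥ h) =
      M.marginal x ⬝ᵥ h + M.marginal y ⬝ᵥ h - M.init ⬝ᵥ h := by
  rw [← add_dotProduct, ← sub_dotProduct]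
  have hflow : (fun s' => ∑ s, ∑ a ∈ M.avail s, y s a * M.trans s a s') =
      M.marginal x + M.marginal y - M.init :=
    funext fun s' => (hq.flow s').trans (congrArg (· - M.init s') Finset.sum_add_distrib)
  rw [← hflow]
  simp only [dotProduct, Finset.sum_mul, Finset.mul_sum, mul_assoc]
  symm
  rw [Finset.sum_comm]
  exact Finset.sum_congr rfl fun s _ => Finset.sum_comm

theorem marginal_nonneg (hq : M.InQ0 x y) (s : S) : 0 ≤ M.marginal x s :=
  MDP.marginal_nonneg fun a ha => (hq.x_mem s a ha).1

theorem sum_marginal (hq : M.InQ0 x y) : ∑ s, M.marginal x s = 1 := by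
  have hone := hq.sum_mul_trans_dotProduct 1
  have hy : ∑ s, ∑ a ∈ M.avail s, y s a * (M.trans s a ⬝ᵥ 1) = ∑ s, M.marginal y s :=
    Finset.sum_congr rfl fun s _ => Finset.sum_congr rfl fun a ha => by
      rw [dotProduct_one, M.trans_sum s a ha, mul_one]
  rw [hy] at hone
  simp only [dotProduct_one, M.init_sum] at hone
  linarith

theorem marginal_eq_zero (hq : M.InQ0 x y) (hs : s ∉ M.recurrentSet) : M.marginal x s = 0 := by
  classical
  exact (Finset.sum_eq_zero_iff_of_nonneg fun f _ => hq.marginal_nonneg f).1 hq.nonrecurrent s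
    (by simpa using hs)

theorem factorsAt (hq : M.InQ0 x y) (hπ : M.IsPolicyFrom x y π) (s : S) : M.FactorsAt π x s :=
  factorsAt_of_eq_div (fun a ha => (hq.x_mem s a ha).1) (hπ.eq_x s)

theorem factorsAt_of_notMem (hq : M.InQ0 x y) (hπ : M.IsPolicyFrom x y π)
    (hs : s ∉ M.recurrentSet) : M.FactorsAt π y s :=
  factorsAt_of_eq_div (hq.y_nonneg s) (hπ.eq_y s (hq.marginal_eq_zero hs).not_gt)

theorem le_policy (hq : M.InQ0 x y) (hπ : M.IsPolicyFrom x y π) (ha : a ∈ M.avail s) :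
    x s a ≤ π s a := by
  rw [hq.factorsAt hπ s a ha]
  refine mul_le_of_le_one_left (hπ.stationaryPolicy.nonneg s a) ?_
  rw [← hq.sum_marginal]
  exact Finset.single_le_sum (fun s _ => hq.marginal_nonneg s) (Finset.mem_univ s)

theorem marginal_vecMul_eq (hq : M.InQ0 x y) (hπ : M.IsPolicyFrom x y π) :
    M.marginal x ᵥ* M.chainMatrix π = M.marginal x :=
  funext fun s' => (marginal_vecMul_chainMatrix (hq.factorsAt hπ)).trans (hq.stationary s')

theorem marginal_pos_iff (hq : M.InQ0 x y)
    (hpos : ∀ s ∈ M.recurrentSet, ∀ a ∈ M.avail s, 0 < x s a) :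
    0 < M.marginal x s ↔ s ∈ M.recurrentSet :=
  ⟨fun hs => by_contra fun hsr => hs.ne' (hq.marginal_eq_zero hsr),
    fun hs => marginal_pos (hpos s hs)⟩

theorem trans_dotProduct_eq (hq : M.InQ0 x y) (hπ : M.IsPolicyFrom x y π) {h : S → ℝ}
    (hh : M.chainMatrix π *ᵥ h = h) (ha : a ∈ M.avail s) (hpos : 0 < x s a) :
    M.trans s a ⬝ᵥ h = h s := by
  classical
  have hmarg : 0 < M.marginal x s :=
    hpos.trans_le (Finset.single_le_sum (fun b hb => (hq.x_mem s b hb).1) ha)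
  have hconst (s' : S) : M.trans s a s' * h s' = M.trans s a s' * h s := by
    rcases (M.trans_nonneg s a ha s').eq_or_lt with hzero | hT
    · rw [← hzero, zero_mul, zero_mul]
    · have hedge : 0 < M.chainMatrix π s s' :=
        chainTrans_pos hπ.stationaryPolicy ha (hpos.trans_le (hq.le_policy hπ ha)) hT
      rw [eq_of_le_mulVec_of_pos hπ.stationaryPolicy.chainMatrix_mem_rowStochastic
        hq.marginal_nonneg (hq.marginal_vecMul_eq hπ) hh.ge hmarg hedge]
  rw [dotProduct, Finset.sum_congr rfl fun s' _ => hconst s', ← Finset.sum_mul,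
    M.trans_sum s a ha, one_mul]

theorem init_dotProduct_eq (hq : M.InQ0 x y) (hπ : M.IsPolicyFrom x y π)
    (hpos : ∀ s ∈ M.recurrentSet, ∀ a ∈ M.avail s, 0 < x s a) {h : S → ℝ}
    (hh : M.chainMatrix π *ᵥ h = h) : M.init ⬝ᵥ h = M.marginal x ⬝ᵥ h := by
  have hy : ∑ s, ∑ a ∈ M.avail s, y s a * (M.trans s a ⬝ᵥ h) = M.marginal y ⬝ᵥ h := by
    refine Finset.sum_congr rfl fun s _ => ?_
    by_cases hs : s ∈ M.recurrentSet
    · rw [marginal, Finset.sum_mul]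
      exact Finset.sum_congr rfl fun a ha => by
        rw [hq.trans_dotProduct_eq hπ hh ha (hpos s hs a ha)]
    · rw [(hq.factorsAt_of_notMem hπ hs).sum_mul_trans_dotProduct, hh]
  linarith [hq.sum_mul_trans_dotProduct h]

theorem isSteadyState (hq : M.InQ0 x y) (hπ : M.IsPolicyFrom x y π)
    (hpos : ∀ s ∈ M.recurrentSet, ∀ a ∈ M.avail s, 0 < x s a) : M.IsSteadyState π x := by
  classical
  have hst := hπ.stationaryPolicy
  exact (isSteadyState_iff hst).2 ⟨isTimeAverageLimit_of_forall_dotProduct_eq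
    hst.chainMatrix_mem_rowStochastic (hq.marginal_vecMul_eq hπ)
    fun _ => hq.init_dotProduct_eq hπ hpos, hq.factorsAt hπ⟩

theorem recurrentSetOf_eq (hq : M.InQ0 x y) (hπ : M.IsPolicyFrom x y π)
    (hpos : ∀ s ∈ M.recurrentSet, ∀ a ∈ M.avail s, 0 < x s a) :
    M.recurrentSetOf π = M.recurrentSet :=
  Set.ext fun _ => ((hq.isSteadyState hπ hpos).marginal_pos_iff hπ.stationaryPolicy).symm.trans
    (hq.marginal_pos_iff hpos)

theorem lpObjective_le (hq : M.InQ0 x y) :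
    M.lpObjective x ≤ ∑ s, ∑ a ∈ M.avail s, |M.meanReward s a| := by
  refine Finset.sum_le_sum fun s _ => Finset.sum_le_sum fun a ha => ?_
  obtain ⟨hx0, hx1⟩ := hq.x_mem s a ha
  calc x s a * M.meanReward s a ≤ x s a * |M.meanReward s a| :=
        mul_le_mul_of_nonneg_left (le_abs_self _) hx0
    _ ≤ |M.meanReward s a| := mul_le_of_le_one_left (abs_nonneg _) hx1

end InQ0

theorem IsSteadyState.exists_inQ0 (hp : M.IsSteadyState π p) (hπ : M.IsStationaryPolicy π)
    (hrec : M.recurrentSetOf π = M.recurrentSet) : ∃ y, M.InQ0 p y := by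
  classical
  have hP := hπ.chainMatrix_mem_rowStochastic
  obtain ⟨hlim, hfac⟩ := (isSteadyState_iff hπ).1 hp
  have hp0 : 0 ≤ M.marginal p := hlim.nonneg hP.1 M.init_nonneg
  have hp1 : ∑ s, M.marginal p s = 1 := by
    simpa [dotProduct_one, M.init_sum] using (hlim.dotProduct_eq hP.1 M.init_nonneg hP.2).symm
  obtain ⟨z, hz0, hz⟩ := hlim.exists_nonneg_sub_vecMul_eq hP M.init_nonneg
  have hmarg := hπ.marginal_mul z
  refine ⟨fun s a => z s * π s a, fun s' => ?_, fun s' => ?_, ?_, fun s a ha => ?_,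
    fun s a _ => mul_nonneg (hz0 s) (hπ.nonneg s a)⟩
  · rw [← marginal_vecMul_chainMatrix hfac, hlim.vecMul_eq hP, marginal]
  · rw [← marginal_vecMul_chainMatrix (π := π) fun s a _ => by rw [hmarg], hmarg,
      Finset.sum_add_distrib]
    have hmarg' := congrFun hmarg s'
    have hz' := congrFun hz s'
    simp only [marginal, Pi.sub_apply] at hmarg' hz'
    linarith
  · refine Finset.sum_eq_zero fun s hs => (hp0 s).antisymm' (not_lt.1 fun hpos => ?_)
    exact (Finset.mem_filter.1 hs).2 (hrec ▸ (hp.marginal_pos_iff hπ).1 hpos)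
  · rw [hfac s a ha]
    have hle : M.marginal p s ≤ 1 :=
      hp1 ▸ Finset.single_le_sum (fun s _ => hp0 s) (Finset.mem_univ s)
    exact ⟨mul_nonneg (hp0 s) (hπ.nonneg s a), mul_le_one₀ hle (hπ.nonneg s a) (hπ.le_one ha)⟩

end MDP

/-- The hypotheses bound every `v i` by `liminf v`, so `v` converges to it. -/
theorem bddAbove_and_tendsto_sSup_sub {ι : Type*} {l : Filter ι} [l.NeBot] {F : ι → Set ℝ}
    {v : ι → ℝ} {B : ℝ} (hmem : ∀ᶠ i in l, v i ∈ F i)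
    (hle : ∀ᶠ i in l, ∀ ρ ∈ F i, ∀ᶠ j in l, ρ ≤ v j) (hB : ∀ᶠ i in l, v i ≤ B) :
    (∀ᶠ i in l, BddAbove (F i)) ∧ Tendsto (fun i => sSup (F i) - v i) l (𝓝 0) := by
  have hub : l.IsBoundedUnder (· ≤ ·) v := ⟨B, hB⟩
  have hF : ∀ᶠ i in l, ∀ ρ ∈ F i, ρ ≤ liminf v l := hle.mono fun i hi ρ hρ =>
    le_liminf_of_le hub.isCoboundedUnder_ge (hi ρ hρ)
  have hv : ∀ᶠ i in l, v i ≤ liminf v l := by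
    filter_upwards [hmem, hF] with i hi hFi using hFi _ hi
  have hlb : l.IsBoundedUnder (· ≥ ·) v :=
    let ⟨i, hi, hlei⟩ := (hmem.and hle).exists
    ⟨v i, hlei _ hi⟩
  have hlim : Tendsto v l (𝓝 (liminf v l)) := tendsto_of_le_liminf_of_limsup_le le_rfl
    (limsup_le_of_le hlb.isCoboundedUnder_le hv) hub hlb
  have hgap : Tendsto (fun i => liminf v l - v i) l (𝓝 0) := by
    simpa using hlim.const_sub (liminf v l)
  refine ⟨hF.mono fun i hi => ⟨_, hi⟩, squeeze_zero' ?_ ?_ hgap⟩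
  · filter_upwards [hmem, hF] with i hi hFi using sub_nonneg.2 (le_csSup ⟨_, hFi⟩ hi)
  · filter_upwards [hmem, hF] with i hi hFi using sub_le_sub_right (csSup_le ⟨_, hi⟩ hFi) _

namespace LMDP

variable {S A : Type*} [Fintype S] {M : LMDP S A} {δ : ℝ} {x y π : S → A → ℝ}

namespace IsFeasible

theorem x_pos (hf : M.IsFeasible δ x y) (hδ : 0 < δ) :
    ∀ s ∈ M.recurrentSet, ∀ a ∈ M.avail s, 0 < x s a :=
  fun s hs a ha => hδ.trans_le (hf.bounded s hs a ha)

theorem isSteadyState (hf : M.IsFeasible δ x y) (hδ : 0 < δ) (hπ : M.IsPolicyFrom x y π) :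
    M.IsSteadyState π x :=
  hf.inQ0.isSteadyState hπ (hf.x_pos hδ)

theorem mem_edgePreservingBdd (hf : M.IsFeasible δ x y) (hδ : 0 < δ)
    (hπ : M.IsPolicyFrom x y π) : π ∈ M.edgePreservingBdd δ :=
  ⟨hπ.stationaryPolicy, hf.inQ0.recurrentSetOf_eq hπ (hf.x_pos hδ), fun s hs a ha =>
    (hf.bounded s hs a ha).trans (hf.inQ0.le_policy hπ ha)⟩

theorem avgReward_eq (hf : M.IsFeasible δ x y) (hδ : 0 < δ) (hπ : M.IsPolicyFrom x y π) :
    M.avgReward π = M.lpObjective x :=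
  (hf.isSteadyState hδ hπ).avgReward_eq

theorem avgReward_mem_admissibleRewards (hf : M.IsFeasible δ x y) (hδ : 0 < δ)
    (hπ : M.IsPolicyFrom x y π) : M.avgReward π ∈ M.admissibleRewards δ :=
  ⟨π, ⟨hf.mem_edgePreservingBdd hδ hπ, x, hf.isSteadyState hδ hπ, hf.specs⟩, rfl⟩

end IsFeasible

theorem exists_eventually_isFeasible (hδ : 0 < δ) {ρ : ℝ} (hρ : ρ ∈ M.admissibleRewards δ) :
    ∃ x y, M.lpObjective x = ρ ∧ ∀ᶠ ε in 𝓝[>] 0, M.IsFeasible ε x y := by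
  obtain ⟨π, ⟨⟨hst, hrec, hbdd⟩, p, hp, hspecs⟩, rfl⟩ := hρ
  have hπ : π ∈ M.edgePreserving := ⟨hst, hrec, fun s hs a ha => hδ.trans_le (hbdd s hs a ha)⟩
  obtain ⟨y, hq⟩ := hp.exists_inQ0 hst hrec
  have hbound : ∀ᶠ ε in 𝓝[>] 0, ∀ s ∈ M.recurrentSet, ∀ a ∈ M.avail s, ε ≤ p s a := by
    refine eventually_all.2 fun s => eventually_imp_distrib_left.2 fun hs =>
      (eventually_all_finset _).2 fun a ha => ?_
    exact eventually_nhdsWithin_of_eventually_nhds (eventually_le_nhds (hp.pos hπ hs ha))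
  exact ⟨p, y, hp.avgReward_eq.symm, hbound.mono fun ε hε => ⟨hq, hspecs, hε⟩⟩

end LMDP

theorem mainTheorem8 {S A : Type*} [Fintype S] (M : LMDP S A) :
    (∀ δ : ℝ, 0 < δ → ∀ x y π : S → A → ℝ,
      M.IsFeasible δ x y → M.IsPolicyFrom x y π → π ∈ M.edgePreservingBdd δ) ∧
    (∀ x y π : ℝ → S → A → ℝ,
      (∀ᶠ δ in 𝓝[>] (0 : ℝ), M.IsOptimal δ (x δ) (y δ) ∧ M.IsPolicyFrom (x δ) (y δ) (π δ)) →
      (∀ᶠ δ in 𝓝[>] (0 : ℝ),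
        (M.admissibleRewards δ).Nonempty ∧ BddAbove (M.admissibleRewards δ)) ∧
      Tendsto (fun δ => sSup (M.admissibleRewards δ) - M.avgReward (π δ))
        (𝓝[>] (0 : ℝ)) (𝓝 0)) := by
  refine ⟨fun δ hδ x y π hf hπ => hf.mem_edgePreservingBdd hδ hπ, fun x y π hopt => ?_⟩
  have hpos : ∀ᶠ δ in 𝓝[>] (0 : ℝ), 0 < δ := eventually_mem_nhdsWithin
  have hmem : ∀ᶠ δ in 𝓝[>] (0 : ℝ), M.avgReward (π δ) ∈ M.admissibleRewards δ := by
    filter_upwards [hopt, hpos] with δ ⟨⟨hf, _⟩, hπ⟩ hδ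
    exact hf.avgReward_mem_admissibleRewards hδ hπ
  have hle : ∀ᶠ δ in 𝓝[>] (0 : ℝ), ∀ ρ ∈ M.admissibleRewards δ,
      ∀ᶠ ε in 𝓝[>] (0 : ℝ), ρ ≤ M.avgReward (π ε) := by
    filter_upwards [hpos] with δ hδ ρ hρ
    obtain ⟨x', y', rfl, hfeas⟩ := LMDP.exists_eventually_isFeasible hδ hρ
    filter_upwards [hopt, hpos, hfeas] with ε ⟨⟨hf, hmax⟩, hπ⟩ hε hf'
    exact (hmax x' y' hf').trans_eq (hf.avgReward_eq hε hπ).symm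
  have hbdd : ∀ᶠ δ in 𝓝[>] (0 : ℝ),
      M.avgReward (π δ) ≤ ∑ s, ∑ a ∈ M.avail s, |M.meanReward s a| := by
    filter_upwards [hopt, hpos] with δ ⟨⟨hf, _⟩, hπ⟩ hδ
    exact (hf.avgReward_eq hδ hπ).trans_le hf.inQ0.lpObjective_le
  obtain ⟨hbddAbove, hlim⟩ := bddAbove_and_tendsto_sSup_sub hmem hle hbdd
  exact ⟨hmem.and hbddAbove |>.mono fun δ h => ⟨⟨_, h.1⟩, h.2⟩, hlim⟩
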